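/- All graphs are finite and simple. For an orientation $D$ of a graph $G$, an Eulerian subdigraph of $D$ is a spanning subdigraph $H$ (i.e. a set of arcs of $D$, possibly empty and not necessarily connected) in which the indegree of every vertex equals its outdegree; it is even or odd according to the parity of its number of arcs. The Alon–Tarsi number $AT(G)$ is the smallest $k$ such that $G$ has an orientation with maximum outdegree $k-1$ for which the number of even Eulerian subdigraphs differs from the number of odd Eulerian subdigraphs. The total graph $T(G)$ has vertex set $V(G)\cup E(G)$ (a disjoint union); two vertices of $G$ are joined if they are adjacent in $G$, a vertex and an edge of $G$ are joined if they are incident, and two distinct edges of $G$ are joined if they share an endpoint. The $T$-sum $G+_T H$ is the graph with vertex set $(V(G)\cup E(G))\times V(H)$ in which $(u_1,u_2)$ and $(v_1,v_2)$ are adjacent if and only if either $u_1=v_1\in V(G)$ and $u_2v_2\in E(H)$, or $u_2=v_2$ and $u_1v_1\in E(T(G))$. Let $P_n$ denote the path with $n$ vertices. **Corollary 3.11.** For all integers $n,m\ge 2$, \[ AT(P_n +_T P_m)= \begin{cases} 4, & \text{if } (n=4 \text{ and } m\ge 5), \text{ or } (n\ge 7 \text{ and } m=2), \text{ or } (n\ge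 5 \text{ and } m\ge 3);\\ 3, & \text{otherwise.} \end{cases} \] -/

import Mathlib

namespace AlonTarsi

/-- The total graph of `G`: its vertices are the vertices and the edges of `G`; two vertices of `G`
are joined when they are adjacent in `G`, a vertex and an edge when they are incident, and two
edges when they are distinct and share an endpoint. -/
def totalGraph {V : Type*} (G : SimpleGraph V) : SimpleGraph (V ⊕ G.edgeSet) where
  Adj
    | Sum.inl u, Sum.inl v => G.Adj u v
    | Sum.inl u, Sum.inr e => u ∈ (e : Sym2 V)
    | Sum.inr e, Sum.inl u => u ∈ (e : Sym2 V)
    | Sum.inr e, Sum.inr f => G.lineGraph.Adj e f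
  symm := by
    constructor
    rintro (u | e) (v | f) h
    · exact G.adj_symm h
    · exact h
    · exact h
    · exact G.lineGraph.adj_symm h
  loopless := by
    constructor
    rintro (u | e) h
    · exact G.irrefl h
    · exact G.lineGraph.irrefl h

/-- The `T`-sum of `G` and `H`: the Cartesian product of the total graph of `G` with `H`, from which
the copies of the edges of `H` at the edge-vertices of the total graph are removed. -/
def tSum {V W : Type*} (G : SimpleGraph V) (H : SimpleGraph W) :
    SimpleGraph ((V ⊕ G.edgeSet) × W) where
  Adj p q :=
    (∃ u : V, p.1 = Sum.inl u ∧ q.1 = Sum.inl u ∧ H.Adj p.2 q.2) ∨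
      (p.2 = q.2 ∧ (totalGraph G).Adj p.1 q.1)
  symm := by
    constructor
    rintro p q (⟨u, hp, hq, h⟩ | ⟨h, h'⟩)
    · exact Or.inl ⟨u, hq, hp, H.adj_symm h⟩
    · exact Or.inr ⟨h.symm, (totalGraph G).adj_symm h'⟩
  loopless := by
    constructor
    rintro p (⟨u, hp, hq, h⟩ | ⟨h, h'⟩)
    · exact H.irrefl h
    · exact (totalGraph G).irrefl h'

section Digraphs

variable {V : Type*}

/-- `D` is an orientation of the simple graph `G`: every edge of `G` receives exactly one of its two
directions, and there are no other arcs (in particular no loops). -/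
structure IsOrientation (G : SimpleGraph V) (D : Digraph V) : Prop where
  adj_iff : ∀ u v, G.Adj u v ↔ D.Adj u v ∨ D.Adj v u
  asymm : ∀ u v, D.Adj u v → ¬ D.Adj v u

/-- The outdegree of `v` in `D`. -/
noncomputable def outDegree (D : Digraph V) (v : V) : ℕ := {w | D.Adj v w}.ncard

/-- The indegree of `v` in `D`. -/
noncomputable def inDegree (D : Digraph V) (v : V) : ℕ := {u | D.Adj u v}.ncard

/-- The maximum outdegree of a digraph on a finite vertex set. -/
noncomputable def maxOutDegree (D : Digraph V) : ℕ := ⨆ v, outDegree D v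

/-- The number of arcs of `D`. -/
noncomputable def arcCount (D : Digraph V) : ℕ := {a : V × V | D.Adj a.1 a.2}.ncard

/-- `H` is an Eulerian subdigraph of `D`: at every vertex its indegree equals its outdegree.
Neither connectedness nor nonemptiness is required. As usual, subdigraphs are taken to be spanning,
that is, they are determined by their sets of arcs. -/
def IsEulerianSub (D H : Digraph V) : Prop :=
  H ≤ D ∧ ∀ v, inDegree H v = outDegree H v

/-- The even Eulerian subdigraphs of `D`. -/
def evenEulerian (D : Digraph V) : Set (Digraph V) :=
  {H | IsEulerianSub D H ∧ Even (arcCount H)}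

/-- The odd Eulerian subdigraphs of `D`. -/
def oddEulerian (D : Digraph V) : Set (Digraph V) :=
  {H | IsEulerianSub D H ∧ Odd (arcCount H)}

/-- The number of even minus the number of odd Eulerian subdigraphs of `D`. -/
noncomputable def diff (D : Digraph V) : ℤ :=
  ((evenEulerian D).ncard : ℤ) - ((oddEulerian D).ncard : ℤ)

/-- The Alon-Tarsi number of a finite graph `G`: the smallest `k` such that `G` has an orientation
with maximum outdegree `k - 1` and with nonzero `diff`. -/
noncomputable def alonTarsiNumber (G : SimpleGraph V) : ℕ :=
  sInf {k | ∃ D : Digraph V, IsOrientation G D ∧ diff D ≠ 0 ∧ maxOutDegree D + 1 = k}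

end Digraphs

end AlonTarsi

open Finset

namespace AlonTarsi

/-! Outdegrees sum to the number of edges, so `|E| > k|V|` forces an outdegree above `k`. For the
T-sum of `P_n` and `P_m`, `|E| > |V|` always holds, and `|E| > 2|V|` means `(n-3)(m-1) > 3`, which
is exactly the first case. This gives the lower bounds 3 and 4. An acyclic orientation with
outdegrees at most 3 always exists, so 4 is always an upper bound.

The upper bound 3 uses that `diff` is, up to sign, a coefficient of the graph polynomial `∏ (x_tail
- x_head)` (`diff_orient`). A coefficient with all exponents at most 2 is extracted by evaluating at
cube roots of unity in `ZMod 7`, as a weighted sum over proper 3-colourings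
(`exists_orientation_of_sum_ne_zero`). Each row of the T-sum is the square of a path, so its proper
3-colourings are arithmetic progressions in `ZMod 3`. The sum thus becomes a transfer-matrix product
on nine states (`sum_coloring_eq`, `chain_rowWeights`). For `n = 2, 3` two transfer steps act on the
starting vector as a nonzero scalar, which settles all `m`; finitely many cases remain to compute.
-/

/-! ### Orientations as Boolean vectors, and the graph polynomial. -/

/-- An enumeration of the edges of `G` by a type `I`, each edge listed once together with a reference
direction from `tail` to `head`. -/
structure EdgeEnum {V : Type*} (G : SimpleGraph V) (I : Type*) where
  /-- the first endpoint of an edge -/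
  tail : I → V
  /-- the second endpoint of an edge -/
  head : I → V
  adj_iff : ∀ u v, G.Adj u v ↔ ∃ i, (tail i = u ∧ head i = v) ∨ (tail i = v ∧ head i = u)
  inj : ∀ i j, (tail i = tail j ∧ head i = head j) ∨ (tail i = head j ∧ head i = tail j) → i = j

namespace EdgeEnum

variable {V I : Type*} {G : SimpleGraph V} (E : EdgeEnum G I)

theorem tail_ne_head (i : I) : E.tail i ≠ E.head i :=
  ((E.adj_iff _ _).2 ⟨i, Or.inl ⟨rfl, rfl⟩⟩).ne

/-- The starting point of edge `i` when the edges in `b` are reversed. -/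
def src (b : I → Bool) (i : I) : V := if b i then E.head i else E.tail i

/-- The end point of edge `i` when the edges in `b` are reversed. -/
def dst (b : I → Bool) (i : I) : V := if b i then E.tail i else E.head i

theorem src_ne_dst (b : I → Bool) (i : I) : E.src b i ≠ E.dst b i := by
  have := E.tail_ne_head i
  unfold src dst
  split_ifs
  · exact this.symm
  · exact this

theorem eq_of_src_dst {b : I → Bool} {i j : I} (h : E.src b i = E.src b j)
    (h' : E.dst b i = E.dst b j) : i = j := by
  apply E.inj
  unfold src dst at *
  split_ifs at * <;> simp_all

theorem eq_of_src_dst_swap {b : I → Bool} {i j : I} (h : E.src b i = E.dst b j)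
    (h' : E.dst b i = E.src b j) : i = j := by
  apply E.inj
  unfold src dst at *
  split_ifs at * <;> simp_all

/-- The digraph formed by the arcs in `s`, when the edges in `b` are reversed. -/
def sub (b s : I → Bool) : Digraph V where
  Adj u v := ∃ i, s i = true ∧ E.src b i = u ∧ E.dst b i = v

/-- The orientation of `G` obtained from the reference orientation by reversing the edges
in `b`. -/
def orient (b : I → Bool) : Digraph V := E.sub b fun _ => true

theorem isOrientation (b : I → Bool) : IsOrientation G (E.orient b) where
  adj_iff u v := by
    rw [E.adj_iff]
    simp only [orient, sub, src, dst, true_and]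
    constructor
    · rintro ⟨i, h | h⟩ <;> cases hb : b i
      · exact Or.inl ⟨i, by simp [hb, h]⟩
      · exact Or.inr ⟨i, by simp [hb, h]⟩
      · exact Or.inr ⟨i, by simp [hb, h]⟩
      · exact Or.inl ⟨i, by simp [hb, h]⟩
    · rintro (⟨i, h⟩ | ⟨i, h⟩) <;> refine ⟨i, ?_⟩ <;> cases hb : b i <;> simp [hb] at h <;>
        simp [h]
  asymm u v := by
    rintro ⟨i, -, h1, h2⟩ ⟨j, -, h3, h4⟩
    obtain rfl := E.eq_of_src_dst_swap (h1.trans h4.symm) (h2.trans h3.symm)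
    exact E.src_ne_dst b i (h1.trans h4.symm)

theorem exists_eq_orient {D : Digraph V} (hD : IsOrientation G D) : ∃ b, D = E.orient b := by
  classical
  refine ⟨fun i => !decide (D.Adj (E.tail i) (E.head i)), ?_⟩
  ext u v
  simp only [orient, sub, src, dst, true_and]
  constructor
  · intro h
    obtain ⟨i, ⟨rfl, rfl⟩ | ⟨rfl, rfl⟩⟩ := (E.adj_iff u v).1 ((hD.adj_iff u v).2 (Or.inl h))
    · exact ⟨i, by simp [h]⟩
    · exact ⟨i, by simp [hD.asymm _ _ h]⟩
  · rintro ⟨i, h1, h2⟩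
    have h3 := (hD.adj_iff _ _).1 ((E.adj_iff _ _).2 ⟨i, Or.inl ⟨rfl, rfl⟩⟩)
    by_cases h : D.Adj (E.tail i) (E.head i)
    · simp [h] at h1 h2
      rwa [← h1, ← h2]
    · simp [h] at h1 h2 h3
      rwa [← h1, ← h2]

theorem sub_le_orient (b s : I → Bool) : E.sub b s ≤ E.orient b := by
  rintro u v ⟨i, -, h⟩
  exact ⟨i, rfl, h⟩

theorem sub_injective (b : I → Bool) : Function.Injective (E.sub b) := by
  intro s t h
  have key : ∀ s t, E.sub b s = E.sub b t → ∀ i, s i = true → t i = true := by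
    intro s t h i hi
    have : (E.sub b s).Adj (E.src b i) (E.dst b i) := ⟨i, hi, rfl, rfl⟩
    rw [h] at this
    obtain ⟨j, hj, h1, h2⟩ := this
    rwa [← E.eq_of_src_dst h1 h2]
  funext i
  rw [Bool.eq_iff_iff]
  exact ⟨key s t h i, key t s h.symm i⟩

theorem exists_eq_sub {b : I → Bool} {H : Digraph V} (h : H ≤ E.orient b) :
    ∃ s, H = E.sub b s := by
  classical
  refine ⟨fun i => decide (H.Adj (E.src b i) (E.dst b i)), ?_⟩
  ext u v
  constructor
  · intro hu
    obtain ⟨i, -, rfl, rfl⟩ := h hu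
    exact ⟨i, by simpa using hu, rfl, rfl⟩
  · rintro ⟨i, hi, rfl, rfl⟩
    simpa using hi

variable [Fintype I]

theorem arcCount_sub (b s : I → Bool) : arcCount (E.sub b s) = #{i | s i = true} := by
  have : {a : V × V | (E.sub b s).Adj a.1 a.2} =
      (fun i => (E.src b i, E.dst b i)) '' ↑({i | s i = true} : Finset I) := by
    ext ⟨u, v⟩
    simp [sub]
  rw [arcCount, this, Set.ncard_image_of_injective, Set.ncard_coe_finset]
  intro i j h
  simp only [Prod.mk.injEq] at h
  exact E.eq_of_src_dst h.1 h.2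

/-- The sign of an orientation relative to the reference orientation. -/
def sign (b : I → Bool) : ℤ := ∏ i, if b i then -1 else 1

theorem sign_xor (b s : I → Bool) : sign (fun i => b i ^^ s i) = sign b * sign s := by
  simp only [sign, ← prod_mul_distrib]
  have h : ∀ p q : Bool, (if (p ^^ q) = true then -1 else 1 : ℤ) =
      (if p = true then -1 else 1) * if q = true then -1 else 1 := by decide
  exact prod_congr rfl fun i _ => h (b i) (s i)

theorem sign_mul_self (b : I → Bool) : sign b * sign b = 1 := by
  rw [← sign_xor]
  simp [sign]

theorem sign_eq (s : I → Bool) : sign s = (-1) ^ #{i | s i = true} := by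
  rw [sign, prod_ite]
  simp

variable [DecidableEq V]

theorem outDegree_sub (b s : I → Bool) (v : V) :
    outDegree (E.sub b s) v = #{i | s i = true ∧ E.src b i = v} := by
  have : {w | (E.sub b s).Adj v w} = E.dst b '' ↑({i | s i = true ∧ E.src b i = v} : Finset I) := by
    ext w
    simp [sub, and_assoc]
  rw [outDegree, this, Set.InjOn.ncard_image, Set.ncard_coe_finset]
  intro i hi j hj h
  simp at hi hj
  exact E.eq_of_src_dst (hi.2.trans hj.2.symm) h

theorem inDegree_sub (b s : I → Bool) (v : V) :
    inDegree (E.sub b s) v = #{i | s i = true ∧ E.dst b i = v} := by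
  have : {w | (E.sub b s).Adj w v} = E.src b '' ↑({i | s i = true ∧ E.dst b i = v} : Finset I) := by
    ext w
    simp only [sub, Set.mem_ofPred_eq, coe_filter, mem_univ, true_and, Set.mem_image]
    exact exists_congr fun i => by tauto
  rw [inDegree, this, Set.InjOn.ncard_image, Set.ncard_coe_finset]
  intro i hi j hj h
  simp at hi hj
  exact E.eq_of_src_dst h (hi.2.trans hj.2.symm)

/-- The number of edges that start at `v` when the edges in `b` are reversed. -/
def out (b : I → Bool) (v : V) : ℕ := #{i | E.src b i = v}

theorem outDegree_orient (b : I → Bool) (v : V) : outDegree (E.orient b) v = E.out b v := by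
  rw [orient, outDegree_sub, out]
  simp

theorem sum_out [Fintype V] (b : I → Bool) : ∑ v, E.out b v = Fintype.card I := by
  have := card_eq_sum_card_fiberwise (s := (univ : Finset I)) (t := (univ : Finset V))
    (f := E.src b) (fun _ _ => by simp)
  simpa [out] using this.symm

theorem out_xor (b s : I → Bool) (v : V) :
    E.out (fun i => b i ^^ s i) v + #{i | s i = true ∧ E.src b i = v} =
      E.out b v + #{i | s i = true ∧ E.dst b i = v} := by
  simp only [out, card_filter, ← sum_add_distrib]
  refine sum_congr rfl fun i _ => ?_
  unfold src dst
  cases hb : b i <;> cases hs : s i <;> simp [hb, hs, add_comm]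

/-- Reversing the arcs of `s` changes each outdegree by the indegree minus the outdegree of `s`, so
Eulerian subdigraphs correspond to reorientations with the same outdegrees. -/
theorem isEulerianSub_sub (b s : I → Bool) :
    IsEulerianSub (E.orient b) (E.sub b s) ↔ E.out (fun i => b i ^^ s i) = E.out b := by
  simp only [IsEulerianSub, E.sub_le_orient, true_and, inDegree_sub, outDegree_sub, funext_iff]
  refine forall_congr' fun v => ?_
  have := E.out_xor b s v
  omega

/-- Up to sign, `diff` is the signed number of orientations with the same outdegrees. -/
theorem diff_orient [DecidableEq I] [Fintype V] (b : I → Bool) :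
    diff (E.orient b) = sign b * ∑ c : I → Bool with E.out c = E.out b, sign c := by
  have he : evenEulerian (E.orient b) = E.sub b '' ↑({s | E.out (fun i => b i ^^ s i) = E.out b ∧
      Even #{i | s i = true}} : Finset (I → Bool)) := by
    ext H
    simp only [evenEulerian, Set.mem_ofPred_eq, coe_filter, mem_univ, true_and, Set.mem_image]
    constructor
    · rintro ⟨h, h'⟩
      obtain ⟨s, rfl⟩ := E.exists_eq_sub h.1
      rw [isEulerianSub_sub] at h
      rw [arcCount_sub] at h'
      exact ⟨s, ⟨h, h'⟩, rfl⟩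
    · rintro ⟨s, ⟨h, h'⟩, rfl⟩
      rw [isEulerianSub_sub, arcCount_sub]
      exact ⟨h, h'⟩
  have ho : oddEulerian (E.orient b) = E.sub b '' ↑({s | E.out (fun i => b i ^^ s i) = E.out b ∧
      Odd #{i | s i = true}} : Finset (I → Bool)) := by
    ext H
    simp only [oddEulerian, Set.mem_ofPred_eq, coe_filter, mem_univ, true_and, Set.mem_image]
    constructor
    · rintro ⟨h, h'⟩
      obtain ⟨s, rfl⟩ := E.exists_eq_sub h.1
      rw [isEulerianSub_sub] at h
      rw [arcCount_sub] at h'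
      exact ⟨s, ⟨h, h'⟩, rfl⟩
    · rintro ⟨s, ⟨h, h'⟩, rfl⟩
      rw [isEulerianSub_sub, arcCount_sub]
      exact ⟨h, h'⟩
  rw [diff, he, ho, Set.ncard_image_of_injective _ (E.sub_injective b),
    Set.ncard_image_of_injective _ (E.sub_injective b), Set.ncard_coe_finset, Set.ncard_coe_finset,
    mul_sum]
  have hs : ∑ c : I → Bool with E.out c = E.out b, sign b * sign c =
      ∑ s : I → Bool with E.out (fun i => b i ^^ s i) = E.out b, sign s := by
    refine sum_nbij' (fun c i => b i ^^ c i) (fun s i => b i ^^ s i) ?_ ?_ ?_ ?_ ?_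
    · intro c hc
      simpa using hc
    · intro s hs
      simpa using hs
    · intro c _
      simp
    · intro s _
      simp
    · intro c _
      rw [sign_xor]
  rw [hs, card_filter, card_filter, sum_filter]
  push_cast
  rw [← sum_sub_distrib]
  refine sum_congr rfl fun s _ => ?_
  rw [sign_eq]
  by_cases h : E.out (fun i => b i ^^ s i) = E.out b
  · rcases Nat.even_or_odd #{i | s i = true} with h' | h'
    · simp [h, h', h'.neg_one_pow]
    · simp [h, h', h'.neg_one_pow]
  · simp [h]

theorem prod_src {R : Type*} [CommMonoid R] [Fintype V] (x : V → R) (b : I → Bool) :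
    ∏ i, x (E.src b i) = ∏ v, x v ^ E.out b v := by
  rw [← prod_fiberwise univ (E.src b)]
  refine prod_congr rfl fun v _ => ?_
  rw [out, ← prod_const]
  exact prod_congr rfl fun i hi => by rw [(mem_filter.1 hi).2]

/-- Choosing a term from each factor is choosing the source of that edge; the sign counts the
reversed edges. -/
theorem prod_sub_eq_sum {R : Type*} [CommRing R] [DecidableEq I] [Fintype V] (x : V → R) :
    ∏ i, (x (E.tail i) - x (E.head i)) =
      ∑ b : I → Bool, (sign b : R) * ∏ v, x v ^ E.out b v := by
  have : ∀ i, x (E.tail i) - x (E.head i) =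
      ∑ t : Bool, (if t then -1 else 1) * x (if t then E.head i else E.tail i) := by
    intro i
    simp [sub_eq_neg_add]
  simp_rw [this]
  rw [prod_univ_sum, Fintype.piFinset_univ]
  refine sum_congr rfl fun b _ => ?_
  rw [prod_mul_distrib, ← E.prod_src, sign]
  push_cast
  rfl

/-- A strictly decreasing rank along all arcs excludes nonempty Eulerian subdigraphs. -/
theorem diff_orient_ne_zero_of_rank [DecidableEq I] [Fintype V] (b : I → Bool) (r : V → ℤ)
    (h : ∀ i, r (E.dst b i) < r (E.src b i)) : diff (E.orient b) ≠ 0 := by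
  have key : ∀ c : I → Bool, E.out c = E.out b → c = b := by
    intro c hc
    -- The total rank of the sources depends only on the outdegrees. Each source under `b` is the
    -- strictly higher endpoint, so any other orientation has a smaller total. The identity is
    -- `prod_src` written additively.
    have h1 : ∀ c : I → Bool, ∑ i, r (E.src c i) = ∑ v, E.out c v * r v := by
      intro c
      have := E.prod_src (R := Multiplicative ℤ) (fun v => Multiplicative.ofAdd (r v)) c
      apply_fun Multiplicative.toAdd at this
      simpa [toAdd_prod] using this
    have h2 : ∑ i, (r (E.src b i) - r (E.src c i)) = 0 := by
      rw [sum_sub_distrib, h1, h1, hc, sub_self]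
    have h3 : ∀ i, b i ≠ c i → E.src c i = E.dst b i := by
      intro i hi
      unfold src dst
      cases hb : b i <;> cases hc : c i <;> simp_all
    have h4 : ∀ i, 0 ≤ r (E.src b i) - r (E.src c i) := by
      intro i
      by_cases hi : b i = c i
      · simp [src, hi]
      · rw [h3 i hi]
        linarith [h i]
    funext i
    by_contra hi
    have h5 := (sum_eq_zero_iff_of_nonneg fun i _ => h4 i).1 h2 i (mem_univ i)
    rw [h3 i (Ne.symm hi)] at h5
    linarith [h i]
  have : ({c | E.out c = E.out b} : Finset (I → Bool)) = {b} := by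
    ext c
    simp only [mem_filter, mem_univ, true_and, mem_singleton]
    exact ⟨key c, fun h => h ▸ rfl⟩
  rw [diff_orient, this, sum_singleton, sign_mul_self]
  exact one_ne_zero

end EdgeEnum

/-! ### Coefficient extraction by cube roots of unity. -/

/-- The cube roots of unity modulo seven. -/
def cubeRoot : ZMod 3 → ZMod 7 := ![1, 2, 4]

theorem sum_cubeRoot_pow (k : ℕ) : ∑ a, cubeRoot a ^ k = if 3 ∣ k then 3 else 0 := by
  have h : ∀ a, cubeRoot a ^ 3 = 1 := by decide
  have h1 : ∀ a, cubeRoot a ^ k = cubeRoot a ^ (k % 3) := by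
    intro a
    conv_lhs => rw [← Nat.div_add_mod k 3, pow_add, pow_mul, h, one_pow, one_mul]
  simp_rw [h1, Nat.dvd_iff_mod_eq_zero]
  have := Nat.mod_lt k (show 0 < 3 by norm_num)
  interval_cases k % 3 <;> decide

/-- Coefficient extraction by cube roots of unity: a nonvanishing weighted sum over all
three-colourings yields an orientation with prescribed outdegrees and nonzero `diff`. -/
theorem EdgeEnum.exists_orientation_of_sum_ne_zero {V I : Type*} [Fintype V] [DecidableEq V]
    [Fintype I]
    {G : SimpleGraph V} (E : EdgeEnum G I) (w : V → ℕ)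
    (hw : ∀ v, 1 ≤ w v ∧ w v ≤ 3) (hcard : Fintype.card I + ∑ v, w v = 3 * Fintype.card V)
    (h : ∑ c : V → ZMod 3, (∏ v, cubeRoot (c v) ^ w v) *
      ∏ i, (cubeRoot (c (E.tail i)) - cubeRoot (c (E.head i))) ≠ 0) :
    ∃ D, IsOrientation G D ∧ diff D ≠ 0 ∧ ∀ v, outDegree D v ≤ 2 := by
  have := Classical.decEq I
  -- Each `w v + out v` is positive, so divisibility by 3 makes it at least 3; the total is `3|V|`,
  -- so all are equal to 3.
  have hout : ∀ b : I → Bool, (∀ v, 3 ∣ w v + E.out b v) ↔ ∀ v, w v + E.out b v = 3 := by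
    intro b
    refine ⟨fun hb => ?_, fun hb v => by rw [hb v]⟩
    have h1 : ∀ v ∈ univ, 3 ≤ w v + E.out b v := fun v _ =>
      Nat.le_of_dvd (by have := hw v; omega) (hb v)
    have h2 : ∑ v : V, 3 = ∑ v, (w v + E.out b v) := by
      rw [sum_add_distrib, E.sum_out, add_comm, hcard]
      simp [mul_comm]
    intro v
    exact (((sum_eq_sum_iff_of_le h1).1 h2) v (mem_univ v)).symm
  have h1 : ∑ c : V → ZMod 3, (∏ v, cubeRoot (c v) ^ w v) *
      ∏ i, (cubeRoot (c (E.tail i)) - cubeRoot (c (E.head i))) =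
      3 ^ Fintype.card V *
        ((∑ b : I → Bool with ∀ v, w v + E.out b v = 3, sign b : ℤ) : ZMod 7) := by
    have h2 : ∀ c : V → ZMod 3, (∏ v, cubeRoot (c v) ^ w v) *
        ∏ i, (cubeRoot (c (E.tail i)) - cubeRoot (c (E.head i))) =
        ∑ b : I → Bool, (sign b : ZMod 7) * ∏ v, cubeRoot (c v) ^ (w v + E.out b v) := by
      intro c
      rw [E.prod_sub_eq_sum (fun v => cubeRoot (c v)), mul_sum]
      refine sum_congr rfl fun b _ => ?_
      simp_rw [pow_add, prod_mul_distrib]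
      ring
    simp_rw [h2]
    rw [sum_comm]
    push_cast
    rw [mul_sum, sum_filter]
    refine sum_congr rfl fun b _ => ?_
    rw [← mul_sum]
    -- The sum over colourings factors over the vertices, and each factor is 3 or 0 by
    -- `sum_cubeRoot_pow`.
    have h3 := prod_univ_sum (fun _ : V => (univ : Finset (ZMod 3)))
      (fun v a => cubeRoot a ^ (w v + E.out b v))
    rw [Fintype.piFinset_univ] at h3
    rw [← h3]
    simp_rw [sum_cubeRoot_pow]
    by_cases hb : ∀ v, w v + E.out b v = 3
    · simp [hb, mul_comm]
    · rw [if_neg hb]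
      rw [← hout] at hb
      push Not at hb
      obtain ⟨v, hv⟩ := hb
      rw [prod_eq_zero (mem_univ v) (if_neg hv), mul_zero]
  rw [h1] at h
  have h4 : (∑ b : I → Bool with ∀ v, w v + E.out b v = 3, sign b : ℤ) ≠ 0 := by
    intro h0
    rw [h0] at h
    simp at h
  obtain ⟨b, hb, -⟩ := exists_ne_zero_of_sum_ne_zero h4
  replace hb := (mem_filter.1 hb).2
  refine ⟨E.orient b, E.isOrientation b, ?_, fun v => ?_⟩
  · rw [E.diff_orient]
    have h5 : univ.filter (fun c : I → Bool => E.out c = E.out b) =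
        univ.filter fun c : I → Bool => ∀ v, w v + E.out c v = 3 := by
      refine filter_congr fun c _ => ?_
      rw [funext_iff]
      refine forall_congr' fun v => ?_
      have := hb v
      omega
    rw [h5]
    refine mul_ne_zero (fun h0 => ?_) h4
    have := sign_mul_self b
    simp [h0] at this
  · rw [E.outDegree_orient]
    have := hb v
    have := hw v
    omega

/-! ### Lower bounds by counting edges. -/

theorem outDegree_le_maxOutDegree {V : Type*} [Finite V] (D : Digraph V) (v : V) :
    outDegree D v ≤ maxOutDegree D :=
  le_ciSup (Set.finite_range _).bddAbove v

theorem EdgeEnum.card_le_of_isOrientation {V I : Type*} [Fintype V] [Fintype I]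
    {G : SimpleGraph V} (E : EdgeEnum G I) {D : Digraph V} (hD : IsOrientation G D) :
    Fintype.card I ≤ Fintype.card V * maxOutDegree D := by
  classical
  obtain ⟨b, rfl⟩ := E.exists_eq_orient hD
  rw [← E.sum_out b, ← smul_eq_mul, ← card_univ]
  refine sum_le_card_nsmul _ _ _ fun v _ => ?_
  rw [← E.outDegree_orient]
  exact outDegree_le_maxOutDegree _ v

/-- The Alon-Tarsi number is `k + 2` when `G` has too many edges for outdegrees at most `k` and has
a suitable orientation with outdegrees at most `k + 1`. -/
theorem EdgeEnum.alonTarsiNumber_eq {V I : Type*} [Fintype V] [Fintype I] [Nonempty V]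
    {G : SimpleGraph V} (E : EdgeEnum G I) (k : ℕ)
    (hlt : Fintype.card V * k < Fintype.card I)
    (h : ∃ D, IsOrientation G D ∧ diff D ≠ 0 ∧ ∀ v, outDegree D v ≤ k + 1) :
    alonTarsiNumber G = k + 2 := by
  have hlow : ∀ D, IsOrientation G D → k < maxOutDegree D := fun D hD =>
    lt_of_mul_lt_mul_left (hlt.trans_le (E.card_le_of_isOrientation hD)) (Nat.zero_le _)
  obtain ⟨D, hD, hd, hle⟩ := h
  have hmax : maxOutDegree D = k + 1 :=
    le_antisymm (ciSup_le hle) (hlow D hD)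
  refine IsLeast.csInf_eq ⟨⟨D, hD, hd, by omega⟩, ?_⟩
  rintro _ ⟨D', hD', -, rfl⟩
  have := hlow D' hD'
  omega

open SimpleGraph

/-! ### The T-sum of two paths as a grid. -/

/-- The vertices of the total graph of a path, in the order `v₀, e₀, v₁, e₁, …`. -/
def pathVertex (k : ℕ) (p : Fin (2 * k + 3)) : Fin (k + 2) ⊕ (pathGraph (k + 2)).edgeSet :=
  if h : p.val % 2 = 0 then Sum.inl ⟨p.val / 2, by omega⟩
  else Sum.inr ⟨s(⟨p.val / 2, by omega⟩, ⟨p.val / 2 + 1, by omega⟩), by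
    rw [mem_edgeSet, pathGraph_adj]
    exact Or.inl rfl⟩

theorem pathVertex_injective (k : ℕ) : Function.Injective (pathVertex k) := by
  intro p q h
  unfold pathVertex at h
  split_ifs at h
  · simp only [Sum.inl.injEq, Fin.mk.injEq] at h
    omega
  · simp only [Sum.inr.injEq, Subtype.mk.injEq, Sym2.eq_iff, Fin.mk.injEq] at h
    omega

theorem pathVertex_surjective (k : ℕ) : Function.Surjective (pathVertex k) := by
  have key : ∀ (a b : Fin (k + 2)) (h : s(a, b) ∈ (pathGraph (k + 2)).edgeSet),
      a.val + 1 = b.val → ∃ p, pathVertex k p = Sum.inr ⟨s(a, b), h⟩ := by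
    intro a b h hab
    refine ⟨⟨2 * a.val + 1, by omega⟩, ?_⟩
    rw [pathVertex, dif_neg (by simp)]
    simp only [Sum.inr.injEq, Subtype.mk.injEq, Sym2.eq_iff, Fin.ext_iff]
    omega
  rintro (i | ⟨e, he⟩)
  · refine ⟨⟨2 * i.val, by omega⟩, ?_⟩
    simp [pathVertex]
  · induction e using Sym2.ind with
    | _ a b =>
      have h := he
      rw [mem_edgeSet, pathGraph_adj] at h
      rcases h with h | h
      · exact key a b he h
      · obtain ⟨p, hp⟩ := key b a (by rwa [Sym2.eq_swap]) h
        exact ⟨p, by rw [hp]; simp [Sym2.eq_swap]⟩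

/-- In the interleaved order the total graph is the square of a path, so any three consecutive
positions form a triangle. -/
theorem totalGraph_pathGraph_adj (k : ℕ) (p q : Fin (2 * k + 3)) :
    (totalGraph (pathGraph (k + 2))).Adj (pathVertex k p) (pathVertex k q) ↔
      p.val < q.val ∧ q.val ≤ p.val + 2 ∨ q.val < p.val ∧ p.val ≤ q.val + 2 := by
  unfold pathVertex
  split_ifs <;> simp only [totalGraph, pathGraph_adj, lineGraph_adj_iff_exists, Sym2.mem_iff,
    Fin.ext_iff, ne_eq, Subtype.mk.injEq, Sym2.eq_iff]
  · omega
  · omega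
  · omega
  · constructor
    · rintro ⟨h, v, h1, h2⟩
      omega
    · intro h
      refine ⟨by omega, ?_⟩
      rcases h with h | h
      · exact ⟨⟨q.val / 2, by omega⟩, by dsimp only; omega⟩
      · exact ⟨⟨p.val / 2, by omega⟩, by dsimp only; omega⟩

/-- The vertices of the `T`-sum of two paths, arranged in a grid. -/
noncomputable def gridVertex (k m : ℕ) : Fin (2 * k + 3) × Fin m ≃
    (Fin (k + 2) ⊕ (pathGraph (k + 2)).edgeSet) × Fin m :=
  (Equiv.ofBijective _ ⟨pathVertex_injective k, pathVertex_surjective k⟩).prodCongr (Equiv.refl _)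

theorem tSum_pathGraph_adj (k m : ℕ) (x y : Fin (2 * k + 3) × Fin m) :
    (tSum (pathGraph (k + 2)) (pathGraph m)).Adj (gridVertex k m x) (gridVertex k m y) ↔
      (x.1 = y.1 ∧ x.1.val % 2 = 0 ∧ (x.2.val + 1 = y.2.val ∨ y.2.val + 1 = x.2.val)) ∨
      (x.2 = y.2 ∧ (x.1.val < y.1.val ∧ y.1.val ≤ x.1.val + 2 ∨
        y.1.val < x.1.val ∧ x.1.val ≤ y.1.val + 2)) := by
  have hv : ∀ x, gridVertex k m x = (pathVertex k x.1, x.2) := fun _ => rfl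
  rw [← totalGraph_pathGraph_adj, hv, hv]
  simp only [tSum, pathGraph_adj]
  refine or_congr ?_ Iff.rfl
  constructor
  · rintro ⟨u, h1, h2, h3⟩
    refine ⟨pathVertex_injective k (h1.trans h2.symm), ?_, h3⟩
    by_contra h
    rw [pathVertex, dif_neg h] at h1
    cases h1
  · rintro ⟨h1, h2, h3⟩
    refine ⟨⟨x.1.val / 2, by omega⟩, ?_, ?_, h3⟩
    · rw [pathVertex, dif_pos h2]
    · rw [← h1, pathVertex, dif_pos h2]

/-- The edges of the `T`-sum of two paths: those joining neighbours in a row, those joining vertices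
at distance two in a row, and those in the columns. -/
abbrev GridEdge (k l : ℕ) : Type :=
  (Fin (2 * k + 2) × Fin (l + 1)) ⊕ (Fin (2 * k + 1) × Fin (l + 1)) ⊕ (Fin (k + 2) × Fin l)

/-- The endpoint of a grid edge with the larger coordinates. -/
def gridTail (k l : ℕ) : GridEdge k l → Fin (2 * k + 3) × Fin (l + 1)
  | Sum.inl (p, j) => (⟨p.val + 1, by omega⟩, j)
  | Sum.inr (Sum.inl (p, j)) => (⟨p.val + 2, by omega⟩, j)
  | Sum.inr (Sum.inr (i, j)) => (⟨2 * i.val, by omega⟩, ⟨j.val + 1, by omega⟩)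

/-- The endpoint of a grid edge with the smaller coordinates. -/
def gridHead (k l : ℕ) : GridEdge k l → Fin (2 * k + 3) × Fin (l + 1)
  | Sum.inl (p, j) => (⟨p.val, by omega⟩, j)
  | Sum.inr (Sum.inl (p, j)) => (⟨p.val, by omega⟩, j)
  | Sum.inr (Sum.inr (i, j)) => (⟨2 * i.val, by omega⟩, ⟨j.val, by omega⟩)

/-- The edges of the `T`-sum of two paths. -/
noncomputable def gridEnum (k l : ℕ) :
    EdgeEnum (tSum (pathGraph (k + 2)) (pathGraph (l + 1))) (GridEdge k l) where
  tail i := gridVertex k (l + 1) (gridTail k l i)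
  head i := gridVertex k (l + 1) (gridHead k l i)
  adj_iff u v := by
    obtain ⟨x, rfl⟩ := (gridVertex k (l + 1)).surjective u
    obtain ⟨y, rfl⟩ := (gridVertex k (l + 1)).surjective v
    rw [tSum_pathGraph_adj]
    simp only [EmbeddingLike.apply_eq_iff_eq]
    obtain ⟨⟨p, hp⟩, ⟨j, hj⟩⟩ := x
    obtain ⟨⟨q, hq⟩, ⟨j', hj'⟩⟩ := y
    simp only [Sum.exists, Prod.exists, gridTail, gridHead, Prod.mk.injEq, Fin.ext_iff]
    constructor
    · rintro (⟨rfl, h2, h | h⟩ | ⟨rfl, h | h⟩)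
      · exact Or.inr (Or.inr ⟨⟨p / 2, by omega⟩, ⟨j, by omega⟩, by dsimp only; omega⟩)
      · exact Or.inr (Or.inr ⟨⟨p / 2, by omega⟩, ⟨j', by omega⟩, by dsimp only; omega⟩)
      · by_cases h1 : q = p + 1
        · exact Or.inl ⟨⟨p, by omega⟩, ⟨j, by omega⟩, by dsimp only; omega⟩
        · exact Or.inr (Or.inl ⟨⟨p, by omega⟩, ⟨j, by omega⟩, by dsimp only; omega⟩)
      · by_cases h1 : p = q + 1
        · exact Or.inl ⟨⟨q, by omega⟩, ⟨j, by omega⟩, by dsimp only; omega⟩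
        · exact Or.inr (Or.inl ⟨⟨q, by omega⟩, ⟨j, by omega⟩, by dsimp only; omega⟩)
    · rintro (⟨a, b, h⟩ | ⟨a, b, h⟩ | ⟨a, b, h⟩) <;> omega
  inj := by
    rintro (⟨a, b⟩ | ⟨a, b⟩ | ⟨a, b⟩) (⟨c, d⟩ | ⟨c, d⟩ | ⟨c, d⟩) h <;>
      simp only [EmbeddingLike.apply_eq_iff_eq, gridTail, gridHead, Prod.mk.injEq, Fin.ext_iff] at h <;>
      first
      | (exfalso; omega)
      | (simp only [Sum.inl.injEq, Sum.inr.injEq, Prod.mk.injEq, Fin.ext_iff]; omega)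

theorem card_gridEdge (k l : ℕ) :
    Fintype.card (GridEdge k l) =
      (2 * k + 2) * (l + 1) + ((2 * k + 1) * (l + 1) + (k + 2) * l) := by
  simp [GridEdge]

noncomputable instance (k m : ℕ) :
    Fintype ((Fin (k + 2) ⊕ (pathGraph (k + 2)).edgeSet) × Fin m) :=
  Fintype.ofEquiv _ (gridVertex k m)

theorem card_gridVertex (k m : ℕ) :
    Fintype.card ((Fin (k + 2) ⊕ (pathGraph (k + 2)).edgeSet) × Fin m) = (2 * k + 3) * m := by
  rw [← Fintype.card_congr (gridVertex k m)]
  simp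

/-! ### The acyclic orientation. -/

/-- The `T`-sum of two paths is 3-degenerate. -/
theorem exists_orientation_le_three (k l : ℕ) :
    ∃ D, IsOrientation (tSum (pathGraph (k + 2)) (pathGraph (l + 1))) D ∧ diff D ≠ 0 ∧
      ∀ v, outDegree D v ≤ 3 := by
  classical
  refine ⟨(gridEnum k l).orient fun _ => false, (gridEnum k l).isOrientation _, ?_, fun v => ?_⟩
  -- Every reference arc lowers one coordinate and keeps the other, so the coordinate sum is a rank.
  · refine (gridEnum k l).diff_orient_ne_zero_of_rank _
      (fun v => ((gridVertex k (l + 1)).symm v).1.val + ((gridVertex k (l + 1)).symm v).2.val) ?_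
    rintro (⟨a, b⟩ | ⟨a, b⟩ | ⟨a, b⟩) <;>
      simp [EdgeEnum.src, EdgeEnum.dst, gridEnum, gridTail, gridHead]
  · obtain ⟨x, rfl⟩ := (gridVertex k (l + 1)).surjective v
    rw [EdgeEnum.outDegree_orient, EdgeEnum.out]
    simp only [EdgeEnum.src, gridEnum, Bool.false_eq_true, if_false, EmbeddingLike.apply_eq_iff_eq,
      card_filter, Fintype.sum_sum_type]
    simp only [← card_filter]
    -- A vertex is the tail of at most one edge of each of the three kinds.
    have h1 : #{i : Fin (2 * k + 2) × Fin (l + 1) | gridTail k l (Sum.inl i) = x} ≤ 1 := by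
      refine card_le_one.2 fun a ha b hb => ?_
      have h := (mem_filter.1 ha).2.trans (mem_filter.1 hb).2.symm
      simp only [gridTail, Prod.mk.injEq, Fin.ext_iff] at h
      exact Prod.ext (Fin.ext (by omega)) (Fin.ext (by omega))
    have h2 : #{i : Fin (2 * k + 1) × Fin (l + 1) | gridTail k l (Sum.inr (Sum.inl i)) = x} ≤ 1 := by
      refine card_le_one.2 fun a ha b hb => ?_
      have h := (mem_filter.1 ha).2.trans (mem_filter.1 hb).2.symm
      simp only [gridTail, Prod.mk.injEq, Fin.ext_iff] at h
      exact Prod.ext (Fin.ext (by omega)) (Fin.ext (by omega))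
    have h3 : #{i : Fin (k + 2) × Fin l | gridTail k l (Sum.inr (Sum.inr i)) = x} ≤ 1 := by
      refine card_le_one.2 fun a ha b hb => ?_
      have h := (mem_filter.1 ha).2.trans (mem_filter.1 hb).2.symm
      simp only [gridTail, Prod.mk.injEq, Fin.ext_iff] at h
      exact Prod.ext (Fin.ext (by omega)) (Fin.ext (by omega))
    omega

/-! ### The transfer matrix. -/

/-- The partition function of a chain with site weights `ρ` and transfer kernel `K`, as a function of
the state of the first site. -/
def chain {σ R : Type*} [Fintype σ] [CommRing R] (K : σ → σ → R) :
    (l : ℕ) → (Fin (l + 1) → σ → R) → σ → R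
  | 0, ρ => ρ 0
  | l + 1, ρ => fun s => ρ 0 s * ∑ t, K s t * chain K l (fun j => ρ j.succ) t

/-- The arbitrary `f` is there for the induction: splitting off the first site turns `K s` into the
new `f`. -/
theorem sum_chain {σ R : Type*} [Fintype σ] [CommRing R] (K : σ → σ → R) (l : ℕ) :
    ∀ (ρ : Fin (l + 1) → σ → R) (f : σ → R),
      ∑ s : Fin (l + 1) → σ, f (s 0) * ((∏ j, ρ j (s j)) *
        ∏ j : Fin l, K (s j.castSucc) (s j.succ)) = ∑ s, f s * chain K l ρ s := by
  induction l with
  | zero =>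
    intro ρ f
    rw [← (Equiv.funUnique (Fin 1) σ).symm.sum_comp]
    simp [chain]
  | succ l ih =>
    intro ρ f
    rw [← (Fin.consEquiv fun _ => σ).sum_comp, Fintype.sum_prod_type]
    refine sum_congr rfl fun s _ => ?_
    simp only [chain]
    rw [← ih (fun j => ρ j.succ) (K s), mul_sum, mul_sum]
    refine sum_congr rfl fun t _ => ?_
    rw [Fin.prod_univ_succ, Fin.prod_univ_succ (fun j : Fin (l + 1) => K _ _)]
    simp only [Fin.consEquiv_apply, Fin.cons_zero, Fin.cons_succ, Fin.castSucc_zero,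
      ← Fin.succ_castSucc]
    ring

/-- The colour of the vertex at position `p` of a row whose colours form the arithmetic progression
with first term `s.1` and difference `s.2`. -/
def rowColor (s : ZMod 3 × ZMod 3) (p : ℕ) : ZMod 3 := s.1 + p * s.2

/-- The contribution of the vertices and edges of a row to the colouring sum. -/
def rowFactor (k : ℕ) (w : Fin (2 * k + 3) → ℕ) (s : ZMod 3 × ZMod 3) : ZMod 7 :=
  (∏ p, cubeRoot (rowColor s p.val) ^ w p) *
    ((∏ p : Fin (2 * k + 2), (cubeRoot (rowColor s (p.val + 1)) - cubeRoot (rowColor s p.val))) *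
      ∏ p : Fin (2 * k + 1), (cubeRoot (rowColor s (p.val + 2)) - cubeRoot (rowColor s p.val)))

/-- The contribution of the edges between two consecutive rows to the colouring sum. -/
def colFactor (k : ℕ) (s t : ZMod 3 × ZMod 3) : ZMod 7 :=
  ∏ i : Fin (k + 2), (cubeRoot (rowColor t (2 * i.val)) - cubeRoot (rowColor s (2 * i.val)))

/-- Three distinct elements of `ZMod 3` in any order form an arithmetic progression, so two
neighbouring colours determine the next. -/
theorem eq_rowColor_of_ne {N : ℕ} (c : Fin (N + 2) → ZMod 3)
    (h1 : ∀ p (h : p + 1 < N + 2), c ⟨p + 1, h⟩ ≠ c ⟨p, by omega⟩)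
    (h2 : ∀ p (h : p + 2 < N + 2), c ⟨p + 2, h⟩ ≠ c ⟨p, by omega⟩) :
    ∀ p (h : p < N + 2), c ⟨p, h⟩ = rowColor (c 0, c 1 - c 0) p := by
  have key : ∀ x y z : ZMod 3, y ≠ x → z ≠ y → z ≠ x → z = y + (y - x) := by decide
  intro p
  induction p using Nat.strong_induction_on with
  | _ p ih =>
    intro h
    match p, ih, h with
    | 0, _, _ => simp [rowColor]
    | 1, _, _ => simp [rowColor]
    | p + 2, ih, h =>
      rw [key _ _ _ (h1 p (by omega)) (h1 (p + 1) h) (h2 p h), ih p (by omega), ih (p + 1) (by omega)]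
      simp only [rowColor]
      push_cast
      ring

/-- A colouring with a row that is not a progression gives two adjacent vertices the same colour, so
its term vanishes. -/
theorem sum_coloring_eq (k l : ℕ) (w : Fin (l + 1) → Fin (2 * k + 3) → ℕ) :
    ∑ c : Fin (2 * k + 3) × Fin (l + 1) → ZMod 3, (∏ x, cubeRoot (c x) ^ w x.2 x.1) *
      ∏ i, (cubeRoot (c (gridTail k l i)) - cubeRoot (c (gridHead k l i))) =
    ∑ s, chain (colFactor k) l (fun j => rowFactor k (w j)) s := by
  have hc := sum_chain (colFactor k) l (fun j => rowFactor k (w j)) fun _ => 1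
  simp only [one_mul] at hc
  rw [← hc]
  symm
  refine Fintype.sum_of_injective
    (fun (s : Fin (l + 1) → ZMod 3 × ZMod 3) x => rowColor (s x.2) x.1.val) ?_ _ _ ?_ ?_
  · intro s t h
    funext j
    have h0 := congrFun h (⟨0, by omega⟩, j)
    have h1 := congrFun h (⟨1, by omega⟩, j)
    simp only [rowColor, Nat.cast_zero, zero_mul, add_zero, Nat.cast_one, one_mul] at h0 h1
    rw [h0] at h1
    exact Prod.ext h0 (add_left_cancel h1)
  · intro c hc
    by_contra h
    apply hc
    have hne : ∀ i, c (gridTail k l i) ≠ c (gridHead k l i) := by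
      intro i hi
      exact h (mul_eq_zero_of_right _ (prod_eq_zero (mem_univ i) (by rw [hi, sub_self])))
    refine ⟨fun j => (c (0, j), c (1, j) - c (0, j)), ?_⟩
    funext ⟨⟨p, hp⟩, j⟩
    refine (eq_rowColor_of_ne (N := 2 * k + 1) (fun q => c (q, j)) ?_ ?_ p hp).symm
    · intro q hq
      exact hne (Sum.inl (⟨q, by omega⟩, j))
    · intro q hq
      exact hne (Sum.inr (Sum.inl (⟨q, by omega⟩, j)))
  · intro s
    simp only [rowFactor, colFactor, prod_mul_distrib, Fintype.prod_sum_type, gridTail, gridHead,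
      Fintype.prod_prod_type_right]
    rw [mul_assoc, mul_assoc]
    rfl

/-- The effect of adding a row with weights `w` on the colouring sum. -/
def rowStep (k : ℕ) (w : Fin (2 * k + 3) → ℕ) (u : ZMod 3 × ZMod 3 → ZMod 7) :
    ZMod 3 × ZMod 3 → ZMod 7 :=
  fun s => rowFactor k w s * ∑ t, colFactor k s t * u t

/-- Weights that are constant on the rows between the first and the last one. -/
def rowWeights {α : Type*} (l : ℕ) (w₀ w₁ w₂ : α) (j : Fin (l + 2)) : α :=
  if j = 0 then w₀ else if j = Fin.last (l + 1) then w₂ else w₁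

theorem chain_rowWeights (k l : ℕ) (w₀ w₁ w₂ : Fin (2 * k + 3) → ℕ) :
    chain (colFactor k) (l + 1) (fun j => rowFactor k (rowWeights l w₀ w₁ w₂ j)) =
      rowStep k w₀ ((rowStep k w₁)^[l] (rowFactor k w₂)) := by
  have key : ∀ l, chain (colFactor k) l
      (fun j => rowFactor k (if j = Fin.last l then w₂ else w₁)) =
        (rowStep k w₁)^[l] (rowFactor k w₂) := by
    intro l
    induction l with
    | zero => simp [chain]
    | succ l ih =>
      rw [Function.iterate_succ_apply', ← ih]
      funext s
      simp only [chain, rowStep, ← Fin.succ_last, Fin.succ_inj]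
      rw [if_neg (Fin.succ_ne_zero _).symm]
  rw [← key]
  funext s
  simp only [chain, rowStep, rowWeights, if_true, Fin.succ_ne_zero, if_false, ← Fin.succ_last,
    Fin.succ_inj]

theorem sum_rowWeights (l a b c : ℕ) : ∑ j, rowWeights l a b c j = a + (l * b + c) := by
  rw [Fin.sum_univ_succ, Fin.sum_univ_castSucc]
  have h : ∀ j : Fin l, rowWeights l a b c j.castSucc.succ = b := by
    intro j
    rw [rowWeights, if_neg (Fin.succ_ne_zero _), if_neg]
    rw [← Fin.succ_last, Fin.succ_inj]
    exact (Fin.castSucc_lt_last j).ne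
  simp [h]
  simp [rowWeights]

/-- The transfer-matrix criterion for an orientation of the `T`-sum of two paths with outdegrees at
most two and nonzero `diff`. -/
theorem exists_orientation_le_two (k l : ℕ) (w₀ w₁ w₂ : Fin (2 * k + 3) → ℕ)
    (h₀ : ∀ p, 1 ≤ w₀ p ∧ w₀ p ≤ 3) (h₁ : ∀ p, 1 ≤ w₁ p ∧ w₁ p ≤ 3)
    (h₂ : ∀ p, 1 ≤ w₂ p ∧ w₂ p ≤ 3)
    (hcard : (2 * k + 2) * (l + 2) + ((2 * k + 1) * (l + 2) + (k + 2) * (l + 1)) +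
      (∑ p, w₀ p + (l * ∑ p, w₁ p + ∑ p, w₂ p)) = 3 * ((2 * k + 3) * (l + 2)))
    (h : ∑ s, rowStep k w₀ ((rowStep k w₁)^[l] (rowFactor k w₂)) s ≠ 0) :
    ∃ D, IsOrientation (tSum (pathGraph (k + 2)) (pathGraph (l + 2))) D ∧ diff D ≠ 0 ∧
      ∀ v, outDegree D v ≤ 2 := by
  classical
  set e := gridVertex k (l + 2) with he
  set W := rowWeights l w₀ w₁ w₂ with hW
  refine (gridEnum k (l + 1)).exists_orientation_of_sum_ne_zero
    (fun v => W (e.symm v).2 (e.symm v).1) ?_ ?_ ?_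
  · intro v
    simp only [hW, rowWeights]
    split_ifs
    · exact h₀ _
    · exact h₂ _
    · exact h₁ _
  · rw [card_gridEdge, card_gridVertex, ← e.sum_comp, Fintype.sum_prod_type_right]
    simp only [Equiv.symm_apply_apply]
    rw [← hcard]
    congr 1
    rw [← sum_rowWeights]
    refine sum_congr rfl fun j _ => ?_
    simp only [hW, rowWeights]
    split_ifs <;> rfl
  · rw [← chain_rowWeights, ← sum_coloring_eq] at h
    rw [← (e.arrowCongr (Equiv.refl (ZMod 3))).sum_comp]
    convert h using 4 with c _ i
    · rw [← e.prod_comp]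
      simp [hW]
    · simp [gridEnum, he]

theorem rowStep_smul (k : ℕ) (w : Fin (2 * k + 3) → ℕ) (a : ZMod 7)
    (u : ZMod 3 × ZMod 3 → ZMod 7) : rowStep k w (a • u) = a • rowStep k w u := by
  funext s
  simp only [rowStep, Pi.smul_apply, smul_eq_mul, mul_sum]
  exact sum_congr rfl fun t _ => by ring

/-- If two rows multiply `u` by a scalar, then the colouring sums are governed by the first two. -/
theorem sum_rowStep_iterate_ne_zero (k : ℕ) (w₀ w₁ : Fin (2 * k + 3) → ℕ) (a : ZMod 7)
    (u : ZMod 3 × ZMod 3 → ZMod 7) (ha : a ≠ 0)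
    (hu : rowStep k w₁ (rowStep k w₁ u) = a • u) (h : ∑ s, rowStep k w₀ u s ≠ 0)
    (h' : ∑ s, rowStep k w₀ (rowStep k w₁ u) s ≠ 0) (l : ℕ) :
    ∑ s, rowStep k w₀ ((rowStep k w₁)^[l] u) s ≠ 0 := by
  have : Fact (Nat.Prime 7) := ⟨by norm_num⟩
  have key : ∀ l, ∃ b : ZMod 7, b ≠ 0 ∧
      ((rowStep k w₁)^[l] u = b • u ∨ (rowStep k w₁)^[l] u = b • rowStep k w₁ u) := by
    intro l
    induction l with
    | zero => exact ⟨1, one_ne_zero, Or.inl (by simp)⟩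
    | succ l ih =>
      obtain ⟨b, hb, h | h⟩ := ih <;> rw [Function.iterate_succ_apply', h, rowStep_smul]
      · exact ⟨b, hb, Or.inr rfl⟩
      · exact ⟨b * a, mul_ne_zero hb ha, Or.inl (by rw [hu, smul_smul])⟩
  obtain ⟨b, hb, hl | hl⟩ := key l
  · rw [hl, rowStep_smul]
    simp only [Pi.smul_apply, ← smul_sum]
    exact smul_ne_zero hb h
  · rw [hl, rowStep_smul]
    simp only [Pi.smul_apply, ← smul_sum]
    exact smul_ne_zero hb h'

/-! ### Explicit weights for the cases with value 3. -/

theorem exists_orientation_two (l : ℕ) :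
    ∃ D, IsOrientation (tSum (pathGraph 2) (pathGraph (l + 2))) D ∧ diff D ≠ 0 ∧
      ∀ v, outDegree D v ≤ 2 := by
  -- A weight is 3 minus the prescribed outdegree. Each further row adds 3 vertices and 5 edges,
  -- hence weight `9 - 5 = 4`.
  refine exists_orientation_le_two 0 l ![2, 1, 3] ![1, 1, 2] ![1, 1, 2] (by decide) (by decide)
    (by decide) ?_ ?_
  · simp only [Fin.sum_univ_succ, Fin.sum_univ_zero]
    simp
    ring
  · exact sum_rowStep_iterate_ne_zero 0 _ _ 1 _ (by decide) (by decide +kernel) (by decide +kernel)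
      (by decide +kernel) l

theorem exists_orientation_three (l : ℕ) :
    ∃ D, IsOrientation (tSum (pathGraph 3) (pathGraph (l + 2))) D ∧ diff D ≠ 0 ∧
      ∀ v, outDegree D v ≤ 2 := by
  -- Each further row adds 5 vertices and 10 edges, so middle rows have outdegree 2 throughout; the
  -- total slack `2|V| - |E| = 3` sits in the end rows.
  refine exists_orientation_le_two 1 l ![3, 1, 1, 1, 1] ![1, 1, 1, 1, 1] ![1, 2, 1, 1, 1]
    (by decide) (by decide) (by decide) ?_ ?_
  · simp only [Fin.sum_univ_succ, Fin.sum_univ_zero]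
    simp
    ring
  · exact sum_rowStep_iterate_ne_zero 1 _ _ 2 _ (by decide) (by decide +kernel) (by decide +kernel)
      (by decide +kernel) l

theorem exists_orientation_four (l : ℕ) (hl : l ≤ 2) :
    ∃ D, IsOrientation (tSum (pathGraph 4) (pathGraph (l + 2))) D ∧ diff D ≠ 0 ∧
      ∀ v, outDegree D v ≤ 2 := by
  -- Here `2|V| - |E| = 4 - m = 2 - l` is the excess of the weights over 1, placed in the first row.
  interval_cases l
  · exact exists_orientation_le_two 2 0 ![3, 1, 1, 1, 1, 1, 1] (fun _ => 1) (fun _ => 1)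
      (by decide) (by decide) (by decide) (by decide) (by decide +kernel)
  · exact exists_orientation_le_two 2 1 ![1, 2, 1, 1, 1, 1, 1] (fun _ => 1) (fun _ => 1)
      (by decide) (by decide) (by decide) (by decide) (by decide +kernel)
  -- Tabulating the intermediate vector keeps the kernel from re-evaluating nested transfer steps.
  -- Its zero entries are the constant progressions.
  · have h : rowStep 2 (fun _ => 1) (rowStep 2 (fun _ => 1) (rowFactor 2 fun _ => 1)) =
        fun s => ![![0, 1, 6], ![0, 4, 3], ![0, 2, 5]] s.1 s.2 := by
      decide +kernel
    exact exists_orientation_le_two 2 2 (fun _ => 1) (fun _ => 1) (fun _ => 1)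
      (by decide) (by decide) (by decide) (by decide) (by
        rw [Function.iterate_succ_apply', Function.iterate_one, h]
        decide +kernel)

theorem exists_orientation_five :
    ∃ D, IsOrientation (tSum (pathGraph 5) (pathGraph 2)) D ∧ diff D ≠ 0 ∧
      ∀ v, outDegree D v ≤ 2 :=
  exists_orientation_le_two 3 0 ![2, 1, 1, 1, 1, 1, 1, 1, 1] (fun _ => 1) (fun _ => 1)
    (by decide) (by decide) (by decide) (by decide) (by decide +kernel)

theorem exists_orientation_six :
    ∃ D, IsOrientation (tSum (pathGraph 6) (pathGraph 2)) D ∧ diff D ≠ 0 ∧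
      ∀ v, outDegree D v ≤ 2 :=
  exists_orientation_le_two 4 0 (fun _ => 1) (fun _ => 1) (fun _ => 1)
    (by decide) (by decide) (by decide) (by decide) (by decide +kernel)

theorem exists_orientation_le_two_of_not {n m : ℕ} (hn : 2 ≤ n) (hm : 2 ≤ m)
    (h : ¬((n = 4 ∧ 5 ≤ m) ∨ (7 ≤ n ∧ m = 2) ∨ (5 ≤ n ∧ 3 ≤ m))) :
    ∃ D, IsOrientation (tSum (pathGraph n) (pathGraph m)) D ∧ diff D ≠ 0 ∧
      ∀ v, outDegree D v ≤ 2 := by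
  obtain ⟨l, rfl⟩ := Nat.exists_eq_add_of_le' hm
  have hn6 : n ≤ 6 := by omega
  interval_cases n
  · exact exists_orientation_two l
  · exact exists_orientation_three l
  · exact exists_orientation_four l (by omega)
  · obtain rfl : l = 0 := by omega
    exact exists_orientation_five
  · obtain rfl : l = 0 := by omega
    exact exists_orientation_six

end AlonTarsi

theorem corollary3p11 (n m : ℕ) (hn : 2 ≤ n) (hm : 2 ≤ m) :
    AlonTarsi.alonTarsiNumber
        (AlonTarsi.tSum (SimpleGraph.pathGraph n) (SimpleGraph.pathGraph m)) =
      if (n = 4 ∧ 5 ≤ m) ∨ (7 ≤ n ∧ m = 2) ∨ (5 ≤ n ∧ 3 ≤ m) then 4 else 3 := by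
  split_ifs with h
  · obtain ⟨k, rfl⟩ := Nat.exists_eq_add_of_le' hn
    obtain ⟨l, rfl⟩ := Nat.exists_eq_add_of_le' hm
    refine (AlonTarsi.gridEnum k (l + 1)).alonTarsiNumber_eq 2 ?_
      (AlonTarsi.exists_orientation_le_three k (l + 1))
    rw [AlonTarsi.card_gridVertex, AlonTarsi.card_gridEdge]
    rcases h with ⟨h1, h2⟩ | ⟨h1, h2⟩ | ⟨h1, h2⟩
    · obtain rfl : k = 2 := by omega
      omega
    · obtain rfl : l = 0 := by omega
      omega
    -- With `n = a + 5` and `m = b + 3` the only nonlinear term is `a * b`, which `omega` can treat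
    -- as a natural-number atom.
    · obtain ⟨a, rfl⟩ := Nat.exists_eq_add_of_le' (show 3 ≤ k by omega)
      obtain ⟨b, rfl⟩ := Nat.exists_eq_add_of_le' (show 1 ≤ l by omega)
      ring_nf
      omega
  · have hD := AlonTarsi.exists_orientation_le_two_of_not hn hm h
    obtain ⟨k, rfl⟩ := Nat.exists_eq_add_of_le' hn
    obtain ⟨l, rfl⟩ := Nat.exists_eq_add_of_le' hm
    refine (AlonTarsi.gridEnum k (l + 1)).alonTarsiNumber_eq 1 ?_ hD
    rw [AlonTarsi.card_gridVertex, AlonTarsi.card_gridEdge]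
    ring_nf
    omega
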